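/- **Setting.** Let $(\Omega,(\mathcal F_n)_{0\le n\le N},\mathbb P)$ be a filtered probability space whose initial $\sigma$-algebra $\mathcal F_0$ is trivial (each of its events has probability $0$ or $1$). Let $\delta t,Q,\sigma,\gamma>0$. Let $\epsilon_1,\dots,\epsilon_N$ be i.i.d. with mean $0$, variance $1$ and $\mathbb E[e^{t\epsilon_1}]<\infty$ for all $t\ge 0$, with $\epsilon_n$ being $\mathcal F_n$-measurable. Let $V_1,\dots,V_N$ be $\mathcal F_0$-measurable and almost surely positive (hence almost surely constant). Let $L:\mathbb R\to\mathbb R_+$ be continuous, even, strictly convex and increasing on $\mathbb R_+$, with $L(0)=0$ and $L(\rho)/\rho\to+\infty$ as $\rho\to+\infty$. Let $\ell:\mathbb R\to[0,+\infty]$ be convex, even and nondecreasing on $\mathbb R_+$, with $\ell(0)=0$. Let $\mathcal N\subset\{1,\dots,N-1\}$ be non-empty. For $0\le n\le N$ let $\mathcal A_n$ be the set of pairs $(v,n^\star)$ where $v=(v_k)_{n\le k\le n^\star-1}$ is a real-valued adapted process and $n^\star$ is a stopping time with values in $(\mathcal N\cup\{N\})\cap\{n,\dots,N\}$; let $\mathcal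 A=\mathcal A_0$. For real $x,q,S,A$ and for $n\le k\le N$, $k>0$, put $$q_k^{n,q,v}=q-\sum_{j=n}^{k-1}v_j\delta t,\qquad S_k^{n,S}=S+\sigma\sqrt{\delta t}\sum_{j=n}^{k-1}\epsilon_{j+1},$$ $$X_k^{n,x,v}=x+\sum_{j=n}^{k-1}\Big(v_jS_{j+1}^{n,S}\delta t+L\Big(\frac{v_j}{V_{j+1}}\Big)V_{j+1}\delta t\Big),\qquad A_k^{n,A,S}=\frac nkA+\frac1k\sum_{j=n}^{k-1}S_{j+1}^{n,S}.$$ The first formula is also used for $k=0$. For the initial price $S_0\in\mathbb R$ write $q_k,S_k,X_k,A_k$ for these quantities with $n=0$, $x=0$, $q=Q$, $S=S_0$; then $A_k=\frac1k\sum_{i=1}^kS_i$. The value functions are $$u_n(x,q,S,A)=\sup_{(v,n^\star)\in\mathcal A_n}\mathbb E\Big[-\exp\Big(-\gamma\big(QA^{n,A,S}_{n^\star}-X^{n,x,v}_{n^\star}-q^{n,q,v}_{n^\star}S^{n,S}_{n^\star}-\ell(q^{n,q,v}_{n^\star})\big)\Big)\Big],$$ where $u_0$ does not depend on $A$ and is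 written $u_0(x,q,S)$. The indifference price of the ASR contract is $$\Pi=\inf\Big\{p\in\mathbb R\ \Big|\ \sup_{(v,n^\star)\in\mathcal A}\mathbb E\Big[-\exp\Big(-\gamma\big(p+QA_{n^\star}-X_{n^\star}-q_{n^\star}S_{n^\star}-\ell(q_{n^\star})\big)\Big)\Big]\ge-1\Big\}.$$ For $1\le n\le N$ and $q,Z\in\mathbb R$ let $\theta_n(q,Z)\in[-\infty,+\infty]$ be $$\theta_n(q,Z)=\inf_{(v,n^\star)\in\mathcal A_n}\frac1\gamma\log\mathbb E\Big[\exp\Big(\gamma\Big(\sigma\sqrt{\delta t}\Big(\sum_{j=n}^{n^\star-1}\Big(q^{n,q,v}_j-\Big(1-\frac j{n^\star}\Big)Q\Big)\epsilon_{j+1}-\Big(1-\frac n{n^\star}\Big)QZ\Big)+\sum_{j=n}^{n^\star-1}L\Big(\frac{v_j}{V_{j+1}}\Big)V_{j+1}\delta t+\ell(q^{n,q,v}_{n^\star})\Big)\Big)\Big].$$ (The expectations of nonpositive and nonnegative variables are taken in $[-\infty,0]$ and in $[0,+\infty]$.) **Proposition.** The value $u_0(0,Q,S_0)$ is a negative real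 number, the price $\Pi$ is a real number, neither of them depends on $S_0$, and, almost surely, $$\Pi=\frac1\gamma\log\big(-u_0(0,Q,S_0)\big)=\inf_{v\in\mathbb R}\Big\{L\Big(\frac v{V_1}\Big)V_1\,\delta t+\theta_1(Q-v\,\delta t,0)\Big\}.$$ ("Almost surely" concerns only $V_1$, which is almost surely a constant.) -/

import Mathlib

open MeasureTheory ProbabilityTheory Set Filter
open scoped ENNReal NNReal

/-- The market and the accelerated share repurchase (ASR) contract, on the probability space
`(Ω, P)`.  Days are indexed by `0, …, N`; the values of the processes at later indices are
irrelevant. -/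
structure ASRModel {Ω : Type*} [MeasurableSpace Ω] (P : Measure Ω) where
  /-- number of days until maturity -/
  N : ℕ
  /-- length of a day -/
  δt : ℝ
  δt_pos : 0 < δt
  /-- number of shares to repurchase -/
  Q : ℝ
  Q_pos : 0 < Q
  /-- volatility -/
  σ : ℝ
  σ_pos : 0 < σ
  /-- absolute risk aversion of the bank -/
  γ : ℝ
  γ_pos : 0 < γ
  /-- the flow of information -/
  ℱ : Filtration ℕ (inferInstance : MeasurableSpace Ω)
  /-- the price innovations `ε 1, …, ε N`: adapted, i.i.d., centred, of variance `1`, and with a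
  moment-generating function that is finite on `ℝ₊` -/
  ε : ℕ → Ω → ℝ
  ε_meas : ∀ n ∈ Finset.Icc 1 N, Measurable[ℱ n] (ε n)
  ε_indep : iIndepFun (fun i : Finset.Icc 1 N => ε i) P
  ε_ident : ∀ n ∈ Finset.Icc 1 N, ∀ m ∈ Finset.Icc 1 N, IdentDistrib (ε n) (ε m) P P
  ε_memLp : ∀ n ∈ Finset.Icc 1 N, MemLp (ε n) 2 P
  ε_mean : ∀ n ∈ Finset.Icc 1 N, ∫ ω, ε n ω ∂P = 0
  ε_var : ∀ n ∈ Finset.Icc 1 N, variance (ε n) P = 1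
  ε_mgf : ∀ n ∈ Finset.Icc 1 N, ∀ t : ℝ, 0 ≤ t → Integrable (fun ω => Real.exp (t * ε n ω)) P
  /-- `V n * δt` is the market volume traded on day `n` -/
  V : ℕ → Ω → ℝ
  V_meas : ∀ n ∈ Finset.Icc 1 N, Measurable[ℱ 0] (V n)
  V_pos : ∀ n ∈ Finset.Icc 1 N, ∀ᵐ ω ∂P, 0 < V n ω
  /-- execution cost function -/
  L : ℝ → ℝ
  L_cont : Continuous L
  L_nonneg : ∀ ρ, 0 ≤ L ρ
  L_zero : L 0 = 0
  L_even : ∀ ρ, L (-ρ) = L ρ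
  L_mono : MonotoneOn L (Ici 0)
  L_convex : StrictConvexOn ℝ univ L
  L_superlinear : Tendsto (fun ρ => L ρ / ρ) atTop atTop
  /-- the early delivery dates that are open to the bank -/
  dates : Finset ℕ
  dates_nonempty : dates.Nonempty
  dates_mem : ∀ n ∈ dates, 1 ≤ n ∧ n < N
  /-- penalty for the shares that are still to be bought at delivery; the value `∞` is allowed,
  so that the convex indicator of `{0}` is covered -/
  ℓ : ℝ → ℝ≥0∞
  ℓ_zero : ℓ 0 = 0
  ℓ_even : ∀ q, ℓ (-q) = ℓ q
  ℓ_mono : MonotoneOn ℓ (Ici 0)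
  ℓ_convex : ConvexOn ℝ≥0 univ ℓ

namespace ASRModel

variable {Ω : Type*} [MeasurableSpace Ω] {P : Measure Ω}

/-- Admissible strategies from day `n` on: `v` is adapted and `τ` is a stopping time with values
in `(dates ∪ {N}) ∩ {n, …, N}`.  Only the values `v j` with `n ≤ j < τ` matter below; a trading
rate given up to time `τ` only can be extended by `0`. -/
def Admissible (M : ASRModel P) (n : ℕ) (v : ℕ → Ω → ℝ) (τ : Ω → ℕ) : Prop :=
  (∀ j, n ≤ j → j < M.N → Measurable[M.ℱ j] (v j)) ∧
  IsStoppingTime M.ℱ (fun ω => (τ ω : WithTop ℕ)) ∧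
  ∀ ω, (τ ω ∈ M.dates ∨ τ ω = M.N) ∧ n ≤ τ ω ∧ τ ω ≤ M.N

/-! ### The processes of the contract, from inception -/

/-- The price `S_n` that starts from `S₀`. -/
noncomputable def price (M : ASRModel P) (S₀ : ℝ) : ℕ → Ω → ℝ
  | 0, _ => S₀
  | n + 1, ω => M.price S₀ n ω + M.σ * √M.δt * M.ε (n + 1) ω

/-- The average price `A_n`, for `1 ≤ n`. -/
noncomputable def avg (M : ASRModel P) (S₀ : ℝ) (n : ℕ) (ω : Ω) : ℝ :=
  (1 / (n : ℝ)) * ∑ k ∈ Finset.Icc 1 n, M.price S₀ k ω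

/-- The number `q_n` of shares that remain to be bought. -/
noncomputable def inventory (M : ASRModel P) (v : ℕ → Ω → ℝ) : ℕ → Ω → ℝ
  | 0, _ => M.Q
  | n + 1, ω => M.inventory v n ω - v n ω * M.δt

/-- The cash `X_n` spent by the bank. -/
noncomputable def cash (M : ASRModel P) (S₀ : ℝ) (v : ℕ → Ω → ℝ) : ℕ → Ω → ℝ
  | 0, _ => 0
  | n + 1, ω => M.cash S₀ v n ω + v n ω * M.price S₀ (n + 1) ω * M.δt
      + M.L (v n ω / M.V (n + 1) ω) * M.V (n + 1) ω * M.δt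

/-- The expected utility `𝔼[-exp (-γ W)]` of a random wealth `W` with values in `[-∞, ∞]`.  The
utility is nonpositive, so its expectation is always defined, with values in `[-∞, 0]`. -/
noncomputable def expUtility (M : ASRModel P) (W : Ω → EReal) : EReal :=
  -((∫⁻ ω, EReal.exp (((-M.γ : ℝ) : EReal) * W ω) ∂P : ℝ≥0∞) : EReal)

/-- The terminal wealth `Q A_τ - X_τ - q_τ S_τ - ℓ(q_τ)` of the bank. -/
noncomputable def wealth (M : ASRModel P) (S₀ : ℝ) (v : ℕ → Ω → ℝ) (τ : Ω → ℕ) (ω : Ω) : EReal :=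
  ((M.Q * M.avg S₀ (τ ω) ω - M.cash S₀ v (τ ω) ω
      - M.inventory v (τ ω) ω * M.price S₀ (τ ω) ω : ℝ) : EReal)
    - (M.ℓ (M.inventory v (τ ω) ω) : EReal)

/-- The best expected utility of the bank when it enters the contract and receives `p`. -/
noncomputable def bestUtility (M : ASRModel P) (S₀ p : ℝ) : EReal :=
  ⨆ (v : ℕ → Ω → ℝ) (τ : Ω → ℕ) (_ : M.Admissible 0 v τ),
    M.expUtility (fun ω => (p : EReal) + M.wealth S₀ v τ ω)

/-- The indifference price of the contract: the infimum, in `[-∞, ∞]`, of the real numbers `p`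
for which the best expected utility is at least `-1`. -/
noncomputable def indifferencePrice (M : ASRModel P) (S₀ : ℝ) : EReal :=
  ⨅ (p : ℝ) (_ : (-1 : EReal) ≤ M.bestUtility S₀ p), (p : EReal)

/-! ### The value functions -/

/-- `S_k^{n,S}` -/
noncomputable def priceFrom (M : ASRModel P) (n : ℕ) (S : ℝ) (k : ℕ) (ω : Ω) : ℝ :=
  S + M.σ * √M.δt * ∑ j ∈ Finset.Ico n k, M.ε (j + 1) ω

/-- `q_k^{n,q,v}` -/
noncomputable def inventoryFrom (M : ASRModel P) (n : ℕ) (q : ℝ) (v : ℕ → Ω → ℝ) (k : ℕ) (ω : Ω) :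
    ℝ :=
  q - ∑ j ∈ Finset.Ico n k, v j ω * M.δt

/-- The execution costs on the days from `n` to `k`. -/
noncomputable def costFrom (M : ASRModel P) (n : ℕ) (v : ℕ → Ω → ℝ) (k : ℕ) (ω : Ω) : ℝ :=
  ∑ j ∈ Finset.Ico n k, M.L (v j ω / M.V (j + 1) ω) * M.V (j + 1) ω * M.δt

/-- `X_k^{n,x,v}`, for the starting price `S` -/
noncomputable def cashFrom (M : ASRModel P) (n : ℕ) (x S : ℝ) (v : ℕ → Ω → ℝ) (k : ℕ) (ω : Ω) :
    ℝ :=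
  x + ∑ j ∈ Finset.Ico n k, v j ω * M.priceFrom n S (j + 1) ω * M.δt + M.costFrom n v k ω

/-- `A_k^{n,A,S}`, for `1 ≤ k` -/
noncomputable def avgFrom (M : ASRModel P) (n : ℕ) (A S : ℝ) (k : ℕ) (ω : Ω) : ℝ :=
  ((n : ℝ) / (k : ℝ)) * A + (1 / (k : ℝ)) * ∑ j ∈ Finset.Ico n k, M.priceFrom n S (j + 1) ω

/-- The value function `u_n(x, q, S, A)`. -/
noncomputable def u (M : ASRModel P) (n : ℕ) (x q S A : ℝ) : EReal :=
  ⨆ (v : ℕ → Ω → ℝ) (τ : Ω → ℕ) (_ : M.Admissible n v τ),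
    M.expUtility (fun ω =>
      ((M.Q * M.avgFrom n A S (τ ω) ω - M.cashFrom n x S v (τ ω) ω
          - M.inventoryFrom n q v (τ ω) ω * M.priceFrom n S (τ ω) ω : ℝ) : EReal)
        - (M.ℓ (M.inventoryFrom n q v (τ ω) ω) : EReal))

/-- The part of the argument of the exponential in the definition of `θ_n(q, Z)` that comes before
the penalty. -/
noncomputable def θCost (M : ASRModel P) (n : ℕ) (q Z : ℝ) (v : ℕ → Ω → ℝ) (k : ℕ) (ω : Ω) : ℝ :=
  M.σ * √M.δt *
      (∑ j ∈ Finset.Ico n k,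
          (M.inventoryFrom n q v j ω - (1 - (j : ℝ) / (k : ℝ)) * M.Q) * M.ε (j + 1) ω
        - (1 - (n : ℝ) / (k : ℝ)) * M.Q * Z)
    + M.costFrom n v k ω

/-- The reduced value function `θ_n(q, Z)`, for `1 ≤ n`, with values in `[-∞, ∞]`. -/
noncomputable def θ (M : ASRModel P) (n : ℕ) (q Z : ℝ) : EReal :=
  ⨅ (v : ℕ → Ω → ℝ) (τ : Ω → ℕ) (_ : M.Admissible n v τ),
    ((1 / M.γ : ℝ) : EReal) *
      ENNReal.log (∫⁻ ω, EReal.exp ((M.γ : EReal) *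
        ((M.θCost n q Z v (τ ω) ω : EReal)
          + (M.ℓ (M.inventoryFrom n q v (τ ω) ω) : EReal))) ∂P)

end ASRModel

/-! Abel summation rewrites the terminal wealth before the penalty as minus the reduced cost
`θCost`, from which `S₀` and `A` have disappeared (`wealth_eq_neg_θCost`). With `m = minExpCost 0 Q
0`, the value is therefore `-m` and the best utility with premium `p` is `-exp (-γ p) m`. Once `0 <
m < ∞`, the condition "at least `-1`" reads `p ≥ (1/γ) log m`.

For the last equality, `v 0` and `V 1` are almost surely constant because `ℱ 0` is trivial, and `ε
1` has coefficient `q_0 - Q = 0`. The first day thus contributes a deterministic factor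
(`minExpCost_zero_eq`), and the order isomorphism `(1/γ) log` carries the infimum over that day's
rate to the stated one.

Finiteness comes from a strategy that cancels all the noise. Positivity comes from superlinearity of
`L`: on each path, execution costs outweigh whatever trading can gain from the noise (`le_θCost`).
-/

lemma exists_ae_eq_const_of_measure_eq_zero_or_one {Ω : Type*} {m m0 : MeasurableSpace Ω}
    {P : Measure Ω} [IsProbabilityMeasure P] (hm : m ≤ m0)
    (htriv : ∀ B : Set Ω, MeasurableSet[m] B → P B = 0 ∨ P B = 1)
    {f : Ω → ℝ} (hf : Measurable[m] f) : ∃ c : ℝ, ∀ᵐ ω ∂P, f ω = c := by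
  refine Filter.exists_eventuallyEq_const_of_forall_separating MeasurableSet fun U hU => ?_
  have hB : MeasurableSet[m] (f ⁻¹' U) := hf hU
  rcases htriv _ hB with h | h
  · right
    exact measure_eq_zero_iff_ae_notMem.1 h
  · left
    exact (prob_compl_eq_zero_iff (hm _ hB)).2 h

/-- The map `x ↦ -x` is antitone and continuous and sends `∞` to `⊥`, so an empty index type is
covered; this matters for the nested `iSup` over `Admissible`. -/
lemma EReal.iSup_neg_coe_ennreal {ι : Sort*} (f : ι → ℝ≥0∞) :
    ⨆ i, -(f i : EReal) = -((⨅ i, f i : ℝ≥0∞) : EReal) := by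
  have hanti : Antitone fun x : ℝ≥0∞ => -(x : EReal) := fun x y h =>
    EReal.neg_le_neg_iff.2 (EReal.coe_ennreal_le_coe_ennreal_iff.2 h)
  have hcont : Continuous fun x : ℝ≥0∞ => -(x : EReal) :=
    continuous_neg.comp continuous_coe_ennreal_ereal
  exact (hanti.map_iInf_of_continuousAt hcont.continuousAt (by simp)).symm

namespace ASRModel

variable {Ω : Type*} [MeasurableSpace Ω] {P : Measure Ω}

/-! ### The exponential of the reduced cost -/

/-- The expectation whose logarithm is minimised in the definition of `θ_n(q, Z)`. -/
noncomputable def expCost (M : ASRModel P) (n : ℕ) (q Z : ℝ) (v : ℕ → Ω → ℝ) (τ : Ω → ℕ) : ℝ≥0∞ :=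
  ∫⁻ ω, EReal.exp ((M.γ : EReal) *
    ((M.θCost n q Z v (τ ω) ω : EReal) + (M.ℓ (M.inventoryFrom n q v (τ ω) ω) : EReal))) ∂P

/-- The infimum of `expCost` over the admissible strategies. -/
noncomputable def minExpCost (M : ASRModel P) (n : ℕ) (q Z : ℝ) : ℝ≥0∞ :=
  ⨅ (v : ℕ → Ω → ℝ) (τ : Ω → ℕ) (_ : M.Admissible n v τ), M.expCost n q Z v τ

/-- The certainty equivalent `x ↦ (1 / γ) log x`, as an order isomorphism. -/
noncomputable def certaintyEquiv (M : ASRModel P) : ℝ≥0∞ ≃o EReal :=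
  (ENNReal.orderIsoRpow (1 / M.γ) (one_div_pos.2 M.γ_pos)).trans ENNReal.logOrderIso

lemma certaintyEquiv_apply (M : ASRModel P) (x : ℝ≥0∞) :
    M.certaintyEquiv x = ((1 / M.γ : ℝ) : EReal) * ENNReal.log x := by
  simp only [certaintyEquiv, OrderIso.trans_apply, ENNReal.orderIsoRpow_apply,
    ENNReal.logOrderIso_apply, ENNReal.log_rpow]

lemma θ_eq_certaintyEquiv (M : ASRModel P) (n : ℕ) (q Z : ℝ) :
    M.θ n q Z = M.certaintyEquiv (M.minExpCost n q Z) := by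
  simp only [minExpCost, OrderIso.map_iInf, certaintyEquiv_apply]
  rfl

lemma certaintyEquiv_ofReal_exp_mul (M : ASRModel P) (c : ℝ) (x : ℝ≥0∞) :
    M.certaintyEquiv (ENNReal.ofReal (Real.exp (M.γ * c)) * x) = (c : EReal) + M.certaintyEquiv x := by
  have h0 : (0 : ℝ) ≤ 1 / M.γ := (one_div_pos.2 M.γ_pos).le
  rw [certaintyEquiv_apply, certaintyEquiv_apply, ENNReal.log_mul_add,
    ENNReal.log_ofReal_of_pos (Real.exp_pos _), Real.log_exp,
    EReal.left_distrib_of_nonneg_of_ne_top (EReal.coe_nonneg.2 h0) (EReal.coe_ne_top _),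
    ← EReal.coe_mul]
  congr 2
  field_simp [M.γ_pos.ne']

lemma certaintyEquiv_ofReal (M : ASRModel P) {x : ℝ} (hx : 0 < x) :
    M.certaintyEquiv (ENNReal.ofReal x) = ((1 / M.γ * Real.log x : ℝ) : EReal) := by
  rw [certaintyEquiv_apply, ENNReal.log_ofReal_of_pos hx, EReal.coe_mul]

/-- Translating the real part of the cost. -/
lemma exp_mul_add (M : ASRModel P) (c x : ℝ) (l : EReal) :
    EReal.exp ((M.γ : EReal) * (((c + x : ℝ) : EReal) + l))
      = ENNReal.ofReal (Real.exp (M.γ * c)) * EReal.exp ((M.γ : EReal) * ((x : EReal) + l)) := by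
  rw [EReal.coe_add, add_assoc, EReal.left_distrib_of_nonneg_of_ne_top
    (EReal.coe_nonneg.2 M.γ_pos.le) (EReal.coe_ne_top _), EReal.exp_add, ← EReal.coe_mul,
    EReal.exp_coe]

lemma neg_mul_add_sub (M : ASRModel P) (p x : ℝ) (l : ℝ≥0∞) :
    ((-M.γ : ℝ) : EReal) * ((p : EReal) + (((-x : ℝ) : EReal) - (l : EReal)))
      = (M.γ : EReal) * (((-p + x : ℝ) : EReal) + (l : EReal)) := by
  induction l with
  | top =>
    -- An infinite penalty makes both sides `⊤`, since `γ > 0`.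
    simp only [EReal.coe_ennreal_top, EReal.sub_top, EReal.add_bot, EReal.coe_add_top]
    rw [EReal.coe_mul_bot_of_neg (neg_neg_of_pos M.γ_pos), EReal.coe_mul_top_of_pos M.γ_pos]
  | coe l =>
    have hl : ((l : ℝ≥0∞) : EReal) = ((l : ℝ) : EReal) := rfl
    rw [hl, ← EReal.coe_sub, ← EReal.coe_add, ← EReal.coe_add, ← EReal.coe_mul, ← EReal.coe_mul]
    congr 1
    ring

/-! ### Pathwise identities -/

lemma Admissible.one_le (M : ASRModel P) {n : ℕ} {v : ℕ → Ω → ℝ} {τ : Ω → ℕ}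
    (h : M.Admissible n v τ) (ω : Ω) : 1 ≤ τ ω := by
  obtain ⟨d, hd⟩ := M.dates_nonempty
  have hd := M.dates_mem d hd
  rcases (h.2.2 ω).1 with h | h
  · exact (M.dates_mem _ h).1
  · omega

lemma one_le_N (M : ASRModel P) : 1 ≤ M.N := by
  obtain ⟨d, hd⟩ := M.dates_nonempty
  have hd := M.dates_mem d hd
  omega

lemma price_eq_priceFrom (M : ASRModel P) (S : ℝ) (k : ℕ) (ω : Ω) :
    M.price S k ω = M.priceFrom 0 S k ω := by
  induction k with
  | zero => simp [price, priceFrom]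
  | succ k ih =>
    rw [price, ih, priceFrom, priceFrom, Finset.sum_Ico_succ_top (Nat.zero_le k)]
    ring

lemma priceFrom_succ (M : ASRModel P) (S : ℝ) (k : ℕ) (ω : Ω) :
    M.priceFrom 0 S (k + 1) ω = M.priceFrom 0 S k ω + M.σ * √M.δt * M.ε (k + 1) ω := by
  rw [priceFrom, priceFrom, Finset.sum_Ico_succ_top (Nat.zero_le k)]
  ring

lemma inventoryFrom_succ (M : ASRModel P) (q : ℝ) (v : ℕ → Ω → ℝ) (k : ℕ) (ω : Ω) :
    M.inventoryFrom 0 q v (k + 1) ω = M.inventoryFrom 0 q v k ω - v k ω * M.δt := by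
  rw [inventoryFrom, inventoryFrom, Finset.sum_Ico_succ_top (Nat.zero_le k)]
  ring

lemma inventory_eq_inventoryFrom (M : ASRModel P) (v : ℕ → Ω → ℝ) (k : ℕ) (ω : Ω) :
    M.inventory v k ω = M.inventoryFrom 0 M.Q v k ω := by
  induction k with
  | zero => simp [inventory, inventoryFrom]
  | succ k ih => rw [inventory, ih, inventoryFrom_succ]

lemma cash_eq_cashFrom (M : ASRModel P) (S : ℝ) (v : ℕ → Ω → ℝ) (k : ℕ) (ω : Ω) :
    M.cash S v k ω = M.cashFrom 0 0 S v k ω := by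
  induction k with
  | zero => simp [cash, cashFrom, costFrom]
  | succ k ih =>
    rw [cash, ih, cashFrom, cashFrom, costFrom, costFrom, price_eq_priceFrom,
      Finset.sum_Ico_succ_top (Nat.zero_le k), Finset.sum_Ico_succ_top (Nat.zero_le k)]
    ring

lemma avg_eq_avgFrom (M : ASRModel P) (S A : ℝ) (k : ℕ) (ω : Ω) :
    M.avg S k ω = M.avgFrom 0 A S k ω := by
  simp only [avg, avgFrom, Nat.cast_zero, zero_div, zero_mul, zero_add, price_eq_priceFrom]
  rw [← Finset.Ico_succ_right_eq_Icc, Finset.sum_Ico_eq_sum_range, Finset.sum_Ico_eq_sum_range]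
  simp [add_comm]

/-- Abel summation for the cash spent at the prices `S_1, …, S_k`. -/
lemma sum_mul_priceFrom (M : ASRModel P) (q S : ℝ) (v : ℕ → Ω → ℝ) (k : ℕ) (ω : Ω) :
    ∑ j ∈ Finset.Ico 0 k, v j ω * M.priceFrom 0 S (j + 1) ω * M.δt
        + M.inventoryFrom 0 q v k ω * M.priceFrom 0 S k ω
      = q * S + M.σ * √M.δt *
          ∑ j ∈ Finset.Ico 0 k, M.inventoryFrom 0 q v j ω * M.ε (j + 1) ω := by
  induction k with
  | zero => simp [inventoryFrom, priceFrom]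
  | succ k ih =>
    rw [Finset.sum_Ico_succ_top (Nat.zero_le k), Finset.sum_Ico_succ_top (Nat.zero_le k),
      inventoryFrom_succ]
    have h := M.priceFrom_succ S k ω
    linear_combination ih + M.inventoryFrom 0 q v k ω * h

/-- The innovation `ε (j + 1)` enters the `k - j` prices from day `j + 1` to day `k`. -/
lemma sum_priceFrom (M : ASRModel P) (S : ℝ) (k : ℕ) (ω : Ω) :
    ∑ j ∈ Finset.Ico 0 k, M.priceFrom 0 S (j + 1) ω
      = k * S + M.σ * √M.δt * ∑ j ∈ Finset.Ico 0 k, ((k : ℝ) - j) * M.ε (j + 1) ω := by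
  induction k with
  | zero => simp
  | succ k ih =>
    have h : ∑ j ∈ Finset.Ico 0 (k + 1), (((k + 1 : ℕ) : ℝ) - j) * M.ε (j + 1) ω
        = ∑ j ∈ Finset.Ico 0 k, ((k : ℝ) - j) * M.ε (j + 1) ω
          + ∑ j ∈ Finset.Ico 0 (k + 1), M.ε (j + 1) ω := by
      rw [Finset.sum_Ico_succ_top (Nat.zero_le k), Finset.sum_Ico_succ_top (Nat.zero_le k),
        ← add_assoc, ← Finset.sum_add_distrib]
      congr 1
      · refine Finset.sum_congr rfl fun j _ => ?_
        push_cast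
        ring
      · push_cast
        ring
    rw [Finset.sum_Ico_succ_top (Nat.zero_le k), ih, h, priceFrom]
    push_cast
    ring

/-- The wealth of the bank without the penalty is the opposite of the reduced cost. -/
lemma wealth_eq_neg_θCost (M : ASRModel P) (S A : ℝ) (v : ℕ → Ω → ℝ) {k : ℕ} (hk : 1 ≤ k) (ω : Ω) :
    M.Q * M.avgFrom 0 A S k ω - M.cashFrom 0 0 S v k ω
        - M.inventoryFrom 0 M.Q v k ω * M.priceFrom 0 S k ω = -M.θCost 0 M.Q 0 v k ω := by
  have hk0 : (k : ℝ) ≠ 0 := by positivity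
  have h1 := M.sum_mul_priceFrom M.Q S v k ω
  have h2 : ∑ j ∈ Finset.Ico 0 k, (M.inventoryFrom 0 M.Q v j ω - (1 - (j : ℝ) / k) * M.Q)
        * M.ε (j + 1) ω
      = ∑ j ∈ Finset.Ico 0 k, M.inventoryFrom 0 M.Q v j ω * M.ε (j + 1) ω
        - M.Q * (1 / k) * ∑ j ∈ Finset.Ico 0 k, ((k : ℝ) - j) * M.ε (j + 1) ω := by
    rw [Finset.mul_sum, ← Finset.sum_sub_distrib]
    refine Finset.sum_congr rfl fun j _ => ?_
    field_simp
  -- The weight `(k - j) / k = 1 - j / k` of `ε (j + 1)` in the average is the benchmark inventory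
  -- in `θCost`.
  have h3 : M.avgFrom 0 A S k ω = S + M.σ * √M.δt * (1 / k) *
      ∑ j ∈ Finset.Ico 0 k, ((k : ℝ) - j) * M.ε (j + 1) ω := by
    rw [avgFrom, sum_priceFrom]
    field_simp
    simp
  rw [θCost, h2, h3, cashFrom]
  simp only [mul_zero, sub_zero, zero_add]
  linear_combination -h1

/-- Letting `w` differ from `v` on day `0` allows that day's rate to be overwritten by a constant.
-/
lemma inventoryFrom_zero_eq (M : ASRModel P) (q : ℝ) {v w : ℕ → Ω → ℝ}
    (hvw : ∀ j, 1 ≤ j → v j = w j) {k : ℕ} (hk : 1 ≤ k) (ω : Ω) :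
    M.inventoryFrom 0 q v k ω = M.inventoryFrom 1 (q - v 0 ω * M.δt) w k ω := by
  rw [inventoryFrom, inventoryFrom, Finset.sum_eq_sum_Ico_succ_bot hk, ← sub_sub]
  congr 1
  exact Finset.sum_congr rfl fun j hj => by rw [hvw j (Finset.mem_Ico.1 hj).1]

/-- The first innovation drops out of the reduced cost. -/
lemma θCost_zero_eq (M : ASRModel P) {v w : ℕ → Ω → ℝ} (hvw : ∀ j, 1 ≤ j → v j = w j)
    {k : ℕ} (hk : 1 ≤ k) (ω : Ω) :
    M.θCost 0 M.Q 0 v k ω = M.L (v 0 ω / M.V 1 ω) * M.V 1 ω * M.δt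
      + M.θCost 1 (M.Q - v 0 ω * M.δt) 0 w k ω := by
  have h1 : ∑ j ∈ Finset.Ico 1 k, (M.inventoryFrom 0 M.Q v j ω - (1 - (j : ℝ) / k) * M.Q)
        * M.ε (j + 1) ω
      = ∑ j ∈ Finset.Ico 1 k, (M.inventoryFrom 1 (M.Q - v 0 ω * M.δt) w j ω
        - (1 - (j : ℝ) / k) * M.Q) * M.ε (j + 1) ω :=
    Finset.sum_congr rfl fun j hj => by
      rw [M.inventoryFrom_zero_eq M.Q hvw (Finset.mem_Ico.1 hj).1]
  have h2 : M.costFrom 0 v k ω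
      = M.L (v 0 ω / M.V 1 ω) * M.V 1 ω * M.δt + M.costFrom 1 w k ω := by
    rw [costFrom, costFrom, Finset.sum_eq_sum_Ico_succ_bot hk]
    congr 1
    exact Finset.sum_congr rfl fun j hj => by rw [hvw j (Finset.mem_Ico.1 hj).1]
  have h3 : M.inventoryFrom 0 M.Q v 0 ω = M.Q := by simp [inventoryFrom]
  rw [θCost, θCost, Finset.sum_eq_sum_Ico_succ_bot hk, h1, h2, h3]
  simp only [Nat.cast_zero, zero_div, sub_zero, one_mul, sub_self, zero_mul, zero_add, mul_zero]
  ring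

/-! ### Utility and reduced cost -/

lemma expUtility_eq (M : ASRModel P) (p S A : ℝ) {v : ℕ → Ω → ℝ} {τ : Ω → ℕ}
    (h : M.Admissible 0 v τ) :
    M.expUtility (fun ω => (p : EReal) +
      (((M.Q * M.avgFrom 0 A S (τ ω) ω - M.cashFrom 0 0 S v (τ ω) ω
          - M.inventoryFrom 0 M.Q v (τ ω) ω * M.priceFrom 0 S (τ ω) ω : ℝ) : EReal)
        - (M.ℓ (M.inventoryFrom 0 M.Q v (τ ω) ω) : EReal)))
      = -((ENNReal.ofReal (Real.exp (M.γ * -p)) * M.expCost 0 M.Q 0 v τ : ℝ≥0∞) : EReal) := by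
  rw [expUtility, expCost, ← lintegral_const_mul' _ _ ENNReal.ofReal_ne_top]
  congr 3
  funext ω
  rw [M.wealth_eq_neg_θCost S A v (h.one_le M ω) ω, neg_mul_add_sub, exp_mul_add]

lemma u_zero_eq (M : ASRModel P) (S A : ℝ) :
    M.u 0 0 M.Q S A = -((M.minExpCost 0 M.Q 0 : ℝ≥0∞) : EReal) := by
  simp only [u, minExpCost, ← EReal.iSup_neg_coe_ennreal]
  refine iSup_congr fun v => iSup_congr fun τ => iSup_congr fun h => ?_
  simpa using M.expUtility_eq 0 S A h

lemma bestUtility_eq (M : ASRModel P) (S p : ℝ) :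
    M.bestUtility S p
      = -((ENNReal.ofReal (Real.exp (M.γ * -p)) * M.minExpCost 0 M.Q 0 : ℝ≥0∞) : EReal) := by
  have h0 : ENNReal.ofReal (Real.exp (M.γ * -p)) ≠ 0 := by simp [Real.exp_pos]
  simp only [bestUtility, minExpCost, ENNReal.mul_iInf_of_ne h0 ENNReal.ofReal_ne_top,
    ← EReal.iSup_neg_coe_ennreal]
  refine iSup_congr fun v => iSup_congr fun τ => iSup_congr fun h => ?_
  rw [← M.expUtility_eq p S 0 h]
  simp only [wealth, avg_eq_avgFrom M S 0, cash_eq_cashFrom, inventory_eq_inventoryFrom,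
    price_eq_priceFrom]

/-! ### Dynamic programming on the first day -/

lemma expCost_zero_eq (M : ASRModel P) {v w : ℕ → Ω → ℝ} (hvw : ∀ j, 1 ≤ j → v j = w j)
    {τ : Ω → ℕ} (hτ : ∀ ω, 1 ≤ τ ω) {a V₁ : ℝ} (ha : ∀ᵐ ω ∂P, v 0 ω = a)
    (hV : ∀ᵐ ω ∂P, M.V 1 ω = V₁) :
    M.expCost 0 M.Q 0 v τ = ENNReal.ofReal (Real.exp (M.γ * (M.L (a / V₁) * V₁ * M.δt)))
      * M.expCost 1 (M.Q - a * M.δt) 0 w τ := by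
  rw [expCost, expCost, ← lintegral_const_mul' _ _ ENNReal.ofReal_ne_top]
  refine lintegral_congr_ae ?_
  filter_upwards [ha, hV] with ω ha hV
  rw [M.θCost_zero_eq hvw (hτ ω), M.inventoryFrom_zero_eq M.Q hvw (hτ ω), ha, hV, exp_mul_add]

lemma minExpCost_zero_eq [IsProbabilityMeasure P] (M : ASRModel P)
    (htriv : ∀ B : Set Ω, MeasurableSet[M.ℱ 0] B → P B = 0 ∨ P B = 1) {V₁ : ℝ}
    (hV : ∀ᵐ ω ∂P, M.V 1 ω = V₁) :
    M.minExpCost 0 M.Q 0 = ⨅ a : ℝ, ENNReal.ofReal (Real.exp (M.γ * (M.L (a / V₁) * V₁ * M.δt)))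
      * M.minExpCost 1 (M.Q - a * M.δt) 0 := by
  apply le_antisymm
  · refine le_iInf fun a => ?_
    have h0 : ENNReal.ofReal (Real.exp (M.γ * (M.L (a / V₁) * V₁ * M.δt))) ≠ 0 := by
      simp [Real.exp_pos]
    simp only [minExpCost, ENNReal.mul_iInf_of_ne h0 ENNReal.ofReal_ne_top]
    refine le_iInf fun w => le_iInf fun τ => le_iInf fun h => ?_
    -- A strategy from day `1` is completed by trading at the constant rate `a` on day `0`.
    have hadm : M.Admissible 0 (Function.update w 0 fun _ => a) τ := by
      refine ⟨fun j _ hj => ?_, h.2.1, fun ω => ⟨(h.2.2 ω).1, Nat.zero_le _, (h.2.2 ω).2.2⟩⟩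
      rcases Nat.eq_zero_or_pos j with rfl | hj0
      · rw [Function.update_self]
        exact measurable_const
      · rw [Function.update_of_ne hj0.ne']
        exact h.1 j hj0 hj
    rw [← M.expCost_zero_eq (v := Function.update w 0 fun _ => a)
      (fun j hj => Function.update_of_ne (Nat.one_le_iff_ne_zero.1 hj) _ _)
      (fun ω => h.one_le M ω) (by simp) hV]
    exact iInf_le_of_le _ (iInf_le_of_le _ (iInf_le _ hadm))
  · refine le_iInf fun v => le_iInf fun τ => le_iInf fun h => ?_
    -- Conversely, every first rate is almost surely constant; and since `τ ≥ 1`, the same pair is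
    -- admissible from day `1`.
    obtain ⟨a, ha⟩ := exists_ae_eq_const_of_measure_eq_zero_or_one (M.ℱ.le 0) htriv
      (h.1 0 le_rfl M.one_le_N)
    rw [M.expCost_zero_eq (fun _ _ => rfl) (fun ω => h.one_le M ω) ha hV]
    refine iInf_le_of_le a (mul_le_mul_right ?_ _)
    exact iInf_le_of_le v (iInf_le_of_le τ (iInf_le _ ⟨fun j _ hj => h.1 j (Nat.zero_le j) hj,
      h.2.1, fun ω => ⟨(h.2.2 ω).1, h.one_le M ω, (h.2.2 ω).2.2⟩⟩))

/-! ### Finiteness and positivity -/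

lemma minExpCost_zero_ne_top [IsProbabilityMeasure P] (M : ASRModel P)
    (htriv : ∀ B : Set Ω, MeasurableSet[M.ℱ 0] B → P B = 0 ∨ P B = 1) :
    M.minExpCost 0 M.Q 0 ≠ ∞ := by
  have hV : ∀ j, ∃ c : ℝ, j ∈ Finset.Ico 0 M.N → ∀ᵐ ω ∂P, M.V (j + 1) ω = c := by
    intro j
    by_cases hj : j ∈ Finset.Ico 0 M.N
    · have hj' : j + 1 ∈ Finset.Icc 1 M.N := by
        rw [Finset.mem_Ico] at hj
        rw [Finset.mem_Icc]
        omega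
      obtain ⟨c, hc⟩ := exists_ae_eq_const_of_measure_eq_zero_or_one (M.ℱ.le 0) htriv
        (M.V_meas _ hj')
      exact ⟨c, fun _ => hc⟩
    · exact ⟨0, fun h => absurd h hj⟩
  choose c hc using hV
  have hN : (M.N : ℝ) ≠ 0 := Nat.cast_ne_zero.2 (Nat.one_le_iff_ne_zero.1 M.one_le_N)
  have hδ := M.δt_pos.ne'
  -- Buying evenly until `N` keeps the inventory on the benchmark `(1 - j / N) Q`: the noise
  -- vanishes, and so does the final penalty.
  let b : ℝ := M.Q / (M.N * M.δt)
  have hadm : M.Admissible 0 (fun _ _ => b) (fun _ => M.N) :=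
    ⟨fun _ _ _ => measurable_const, isStoppingTime_const _ _,
      fun _ => ⟨Or.inr rfl, Nat.zero_le _, le_rfl⟩⟩
  have hinv : ∀ (j : ℕ) (ω : Ω), M.inventoryFrom 0 M.Q (fun _ _ => b) j ω
      = (1 - (j : ℝ) / M.N) * M.Q := by
    intro j ω
    simp only [inventoryFrom, Finset.sum_const, Nat.card_Ico, nsmul_eq_mul, b, Nat.sub_zero]
    field_simp
  refine ne_top_of_le_ne_top ?_ (iInf_le_of_le _ (iInf_le_of_le _ (iInf_le _ hadm)))
  have hae : ∀ᵐ ω ∂P, ∀ j ∈ Finset.Ico 0 M.N, M.V (j + 1) ω = c j :=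
    (Filter.eventually_all_finset _).2 hc
  have hconst : M.expCost 0 M.Q 0 (fun _ _ => b) (fun _ => M.N)
      = ∫⁻ _, ENNReal.ofReal (Real.exp (M.γ *
          ∑ j ∈ Finset.Ico 0 M.N, M.L (b / c j) * c j * M.δt)) ∂P := by
    refine lintegral_congr_ae ?_
    filter_upwards [hae] with ω hω
    have hcost : M.θCost 0 M.Q 0 (fun _ _ => b) M.N ω
        = ∑ j ∈ Finset.Ico 0 M.N, M.L (b / c j) * c j * M.δt := by
      simp only [θCost, hinv, sub_self, zero_mul, Finset.sum_const_zero, mul_zero, zero_add,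
        costFrom]
      exact Finset.sum_congr rfl fun j hj => by rw [hω j hj]
    rw [hcost, hinv, div_self hN, sub_self, zero_mul, M.ℓ_zero, EReal.coe_ennreal_zero, add_zero,
      ← EReal.coe_mul, EReal.exp_coe]
  rw [hconst, lintegral_const, measure_univ, mul_one]
  exact ENNReal.ofReal_ne_top

/-- The slope is a natural number so that a choice of `C` as a function of `K` is automatically
measurable. -/
lemma exists_linear_lower_bound (M : ASRModel P) (K : ℕ) :
    ∃ C : ℝ, ∀ ρ, K * |ρ| - C ≤ M.L ρ := by
  obtain ⟨r, hr⟩ := (Filter.eventually_atTop.1 (M.L_superlinear.eventually_ge_atTop (K : ℝ)))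
  refine ⟨K * max r 1, fun ρ => ?_⟩
  rcases le_total (max r 1) |ρ| with h | h
  · have hpos : 0 < |ρ| := by linarith [le_max_right r 1]
    have h1 := hr |ρ| ((le_max_left r 1).trans h)
    rw [le_div_iff₀ hpos] at h1
    have h2 : M.L |ρ| = M.L ρ := by
      rcases abs_choice ρ with h | h <;> rw [h]
      exact M.L_even ρ
    have : 0 ≤ (K : ℝ) * max r 1 := by positivity
    linarith
  · have := mul_le_mul_of_nonneg_left h (Nat.cast_nonneg (α := ℝ) K)
    linarith [M.L_nonneg ρ]

/-- On each path the reduced cost is bounded below, uniformly over the strategies. -/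
lemma le_θCost (M : ASRModel P) {K : ℕ} {C : ℝ} (hC : ∀ ρ, K * |ρ| - C ≤ M.L ρ) {ω : Ω}
    (hV : ∀ n ∈ Finset.Icc 1 M.N, 0 < M.V n ω)
    (hK : M.σ * √M.δt * ∑ j ∈ Finset.range M.N, |M.ε (j + 1) ω| ≤ K)
    (v : ℕ → Ω → ℝ) {k : ℕ} (hkN : k ≤ M.N) :
    -(2 * M.Q * K + C * M.δt * ∑ j ∈ Finset.range M.N, |M.V (j + 1) ω|)
      ≤ M.θCost 0 M.Q 0 v k ω := by
  have hQ := M.Q_pos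
  have hδ := M.δt_pos
  have hs : 0 ≤ M.σ * √M.δt := mul_nonneg M.σ_pos.le (Real.sqrt_nonneg _)
  have hC0 : 0 ≤ C := by simpa [M.L_zero] using hC 0
  have hsub : Finset.Ico 0 k ⊆ Finset.range M.N := fun j hj =>
    Finset.mem_range.2 ((Finset.mem_Ico.1 hj).2.trans_le hkN)
  set R : ℝ := ∑ j ∈ Finset.range M.N, |M.ε (j + 1) ω|
  -- With `T` the total volume traded, the noise term is at least `-(2 Q + T) K` and the execution
  -- cost at least `K T` minus a constant independent of `v`; the terms `K T` cancel.
  set T : ℝ := ∑ j ∈ Finset.Ico 0 k, |v j ω| * M.δt with hT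
  have hT0 : 0 ≤ T := Finset.sum_nonneg fun j _ => by positivity
  have hcoef : ∀ j ∈ Finset.Ico 0 k,
      |M.inventoryFrom 0 M.Q v j ω - (1 - (j : ℝ) / k) * M.Q| ≤ 2 * M.Q + T := by
    intro j hj
    have hjk := (Finset.mem_Ico.1 hj).2
    have hk : (0 : ℝ) < k := by exact_mod_cast (Nat.zero_le j).trans_lt hjk
    have hle : (j : ℝ) / k ≤ 1 := (div_le_one hk).2 (by exact_mod_cast hjk.le)
    have hge : (0 : ℝ) ≤ (j : ℝ) / k := by positivity
    have hsum : |∑ i ∈ Finset.Ico 0 j, v i ω * M.δt| ≤ T := by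
      refine (Finset.abs_sum_le_sum_abs _ _).trans ?_
      simp only [abs_mul, abs_of_pos hδ]
      exact Finset.sum_le_sum_of_subset_of_nonneg (Finset.Ico_subset_Ico_right hjk.le)
        fun i _ _ => by positivity
    rw [inventoryFrom]
    rw [abs_le] at hsum ⊢
    constructor <;> nlinarith
  have hnoise : |M.σ * √M.δt * ∑ j ∈ Finset.Ico 0 k,
      (M.inventoryFrom 0 M.Q v j ω - (1 - (j : ℝ) / k) * M.Q) * M.ε (j + 1) ω|
        ≤ (2 * M.Q + T) * K := by
    have h1 : |∑ j ∈ Finset.Ico 0 k,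
        (M.inventoryFrom 0 M.Q v j ω - (1 - (j : ℝ) / k) * M.Q) * M.ε (j + 1) ω|
          ≤ (2 * M.Q + T) * R := by
      refine (Finset.abs_sum_le_sum_abs _ _).trans ?_
      calc _ ≤ ∑ j ∈ Finset.Ico 0 k, (2 * M.Q + T) * |M.ε (j + 1) ω| :=
            Finset.sum_le_sum fun j hj => by
              rw [abs_mul]
              exact mul_le_mul_of_nonneg_right (hcoef j hj) (abs_nonneg _)
        _ ≤ (2 * M.Q + T) * R := by
            rw [← Finset.mul_sum]
            refine mul_le_mul_of_nonneg_left ?_ (by positivity)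
            exact Finset.sum_le_sum_of_subset_of_nonneg hsub fun _ _ _ => abs_nonneg _
    rw [abs_mul, abs_of_nonneg hs]
    calc _ ≤ M.σ * √M.δt * ((2 * M.Q + T) * R) := mul_le_mul_of_nonneg_left h1 hs
      _ = (2 * M.Q + T) * (M.σ * √M.δt * R) := by ring
      _ ≤ (2 * M.Q + T) * K := mul_le_mul_of_nonneg_left hK (by positivity)
  have hexec : K * T - C * M.δt * ∑ j ∈ Finset.range M.N, |M.V (j + 1) ω|
      ≤ M.costFrom 0 v k ω := by
    calc _ ≤ K * T - C * M.δt * ∑ j ∈ Finset.Ico 0 k, |M.V (j + 1) ω| := by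
          refine sub_le_sub_left (mul_le_mul_of_nonneg_left ?_ (by positivity)) _
          exact Finset.sum_le_sum_of_subset_of_nonneg hsub fun _ _ _ => abs_nonneg _
      _ = ∑ j ∈ Finset.Ico 0 k, (K * |v j ω| - C * |M.V (j + 1) ω|) * M.δt := by
          rw [hT, Finset.mul_sum, Finset.mul_sum, ← Finset.sum_sub_distrib]
          exact Finset.sum_congr rfl fun j _ => by ring
      _ ≤ M.costFrom 0 v k ω := by
          refine Finset.sum_le_sum fun j hj => mul_le_mul_of_nonneg_right ?_ hδ.le
          have hpos : 0 < M.V (j + 1) ω :=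
            hV _ (Finset.mem_Icc.2 ⟨by omega, Finset.mem_range.1 (hsub hj)⟩)
          have h1 := mul_le_mul_of_nonneg_right (hC (v j ω / M.V (j + 1) ω)) hpos.le
          rw [abs_div, abs_of_pos hpos] at h1
          rw [abs_of_pos hpos]
          refine le_trans (le_of_eq ?_) h1
          field_simp
  have := (abs_le.1 hnoise).1
  rw [θCost, mul_zero, sub_zero]
  linarith

lemma minExpCost_zero_ne_zero [IsProbabilityMeasure P] (M : ASRModel P) :
    M.minExpCost 0 M.Q 0 ≠ 0 := by
  choose C hC using M.exists_linear_lower_bound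
  -- The slope varies with the path. The resulting bound `-G` is finite everywhere and free of the
  -- strategy, so the integral of `exp (-γ G)` is a positive lower bound for every expected cost.
  let K : Ω → ℕ := fun ω => ⌈M.σ * √M.δt * ∑ j ∈ Finset.range M.N, |M.ε (j + 1) ω|⌉₊
  let G : Ω → ℝ := fun ω =>
    2 * M.Q * K ω + C (K ω) * M.δt * ∑ j ∈ Finset.range M.N, |M.V (j + 1) ω|
  have hmem : ∀ j ∈ Finset.range M.N, j + 1 ∈ Finset.Icc 1 M.N := fun j hj =>
    Finset.mem_Icc.2 ⟨by omega, Finset.mem_range.1 hj⟩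
  have hKmeas : Measurable K := by
    refine Nat.measurable_ceil.comp (measurable_const.mul ?_)
    exact Finset.measurable_fun_sum _ fun j hj =>
      continuous_abs.measurable.comp ((M.ε_meas _ (hmem j hj)).mono (M.ℱ.le _) le_rfl)
  have hGmeas : Measurable G := by
    refine (measurable_const.mul (measurable_from_nat.comp hKmeas)).add
      (((measurable_from_nat.comp hKmeas).mul measurable_const).mul ?_)
    exact Finset.measurable_fun_sum _ fun j hj =>
      continuous_abs.measurable.comp ((M.V_meas _ (hmem j hj)).mono (M.ℱ.le _) le_rfl)
  have hmeas : Measurable fun ω => ENNReal.ofReal (Real.exp (M.γ * -G ω)) :=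
    (Real.measurable_exp.comp (measurable_const.mul hGmeas.neg)).ennreal_ofReal
  have hpos : 0 < ∫⁻ ω, ENNReal.ofReal (Real.exp (M.γ * -G ω)) ∂P := by
    rw [lintegral_pos_iff_support hmeas]
    have : Function.support (fun ω => ENNReal.ofReal (Real.exp (M.γ * -G ω))) = univ := by
      ext ω
      simp [Real.exp_pos]
    rw [this, measure_univ]
    exact one_pos
  have hV : ∀ᵐ ω ∂P, ∀ n ∈ Finset.Icc 1 M.N, 0 < M.V n ω :=
    (Filter.eventually_all_finset _).2 M.V_pos
  refine (hpos.trans_le (le_iInf fun v => le_iInf fun τ => le_iInf fun h => ?_)).ne'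
  refine lintegral_mono_ae ?_
  filter_upwards [hV] with ω hω
  have hle := M.le_θCost (hC (K ω)) hω (Nat.le_ceil _) v (h.2.2 ω).2.2
  rw [← EReal.exp_coe, EReal.exp_le_exp_iff, EReal.coe_mul]
  refine mul_le_mul_of_nonneg_left ?_ (EReal.coe_nonneg.2 M.γ_pos.le)
  calc ((-G ω : ℝ) : EReal) ≤ (M.θCost 0 M.Q 0 v (τ ω) ω : EReal) := EReal.coe_le_coe_iff.2 hle
    _ ≤ _ := le_add_of_nonneg_right (EReal.coe_ennreal_nonneg _)

end ASRModel

theorem mainTheorem3 {Ω : Type*} [MeasurableSpace Ω] (P : Measure Ω) [IsProbabilityMeasure P]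
    (M : ASRModel P)
    (htriv : ∀ B : Set Ω, MeasurableSet[M.ℱ 0] B → P B = 0 ∨ P B = 1) :
    ∃ price value : ℝ,
      (∀ S₀ : ℝ, M.indifferencePrice S₀ = (price : EReal)) ∧
      (∀ S₀ A : ℝ, M.u 0 0 M.Q S₀ A = (value : EReal)) ∧
      value < 0 ∧
      price = (1 / M.γ) * Real.log (-value) ∧
      ∀ᵐ ω ∂P, (price : EReal) =
        ⨅ v : ℝ, ((M.L (v / M.V 1 ω) * M.V 1 ω * M.δt : ℝ) : EReal) + M.θ 1 (M.Q - v * M.δt) 0 := by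
  obtain ⟨V₁, hV⟩ := exists_ae_eq_const_of_measure_eq_zero_or_one (M.ℱ.le 0) htriv
    (M.V_meas 1 (Finset.mem_Icc.2 ⟨le_rfl, M.one_le_N⟩))
  have htop := M.minExpCost_zero_ne_top htriv
  set x : ℝ := (M.minExpCost 0 M.Q 0).toReal with hx
  have hxpos : 0 < x := ENNReal.toReal_pos M.minExpCost_zero_ne_zero htop
  have hcost : M.minExpCost 0 M.Q 0 = ENNReal.ofReal x := (ENNReal.ofReal_toReal htop).symm
  refine ⟨1 / M.γ * Real.log x, -x, fun S => ?_, fun S A => ?_, neg_neg_of_pos hxpos,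
    by rw [neg_neg], ?_⟩
  -- The acceptable premiums form a closed half-line, whose infimum is its endpoint.
  · have key : ∀ p : ℝ, (-1 : EReal) ≤ M.bestUtility S p ↔ 1 / M.γ * Real.log x ≤ p := by
      intro p
      rw [M.bestUtility_eq, EReal.neg_le_neg_iff, hcost,
        ← ENNReal.ofReal_mul (Real.exp_pos _).le, ← EReal.coe_ennreal_one,
        EReal.coe_ennreal_le_coe_ennreal_iff, ENNReal.ofReal_le_one,
        ← Real.log_nonpos_iff (by positivity), Real.log_mul (Real.exp_pos _).ne' hxpos.ne',
        Real.log_exp, one_div, inv_mul_le_iff₀ M.γ_pos]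
      constructor <;> intro h <;> linarith
    simp only [ASRModel.indifferencePrice, key]
    exact le_antisymm (iInf₂_le (1 / M.γ * Real.log x) le_rfl)
      (le_iInf₂ fun p hp => EReal.coe_le_coe_iff.2 hp)
  · rw [M.u_zero_eq, hcost, EReal.coe_ennreal_ofReal, max_eq_left hxpos.le, EReal.coe_neg]
  · filter_upwards [hV] with ω hω
    rw [← M.certaintyEquiv_ofReal hxpos, ← hcost, M.minExpCost_zero_eq htriv hV,
      OrderIso.map_iInf]
    refine iInf_congr fun v => ?_
    rw [M.certaintyEquiv_ofReal_exp_mul, M.θ_eq_certaintyEquiv, hω]
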